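/- For complex $x,q$ with $|q|<1$ put $(x;q)_n=\prod_{k=0}^{n-1}(1-xq^k)$, $(x;q)_\infty=\prod_{k\ge 0}(1-xq^k)$, $(x_1,\dots,x_m;q)_n=\prod_i(x_i;q)_n$ (also for $n=\infty$), and $${}_2\phi_1\left({A,B\atop C};q,x\right)=\sum_{n\ge 0}\frac{(A,B;q)_n}{(q,C;q)_n}x^n .$$ For a strict partition $\mu=(\mu_1>\mu_2>\cdots>\mu_\ell>0)$ of length $\ell(\mu)=\ell$ (with $\mu_i=0$ for $i>\ell$) let $$\omega(\mu)=a^{\sum_{i\ge1}\lceil\mu_{2i-1}/2\rceil}b^{\sum_{i\ge1}\lfloor\mu_{2i-1}/2\rfloor}c^{\sum_{i\ge1}\lceil\mu_{2i}/2\rceil}d^{\sum_{i\ge1}\lfloor\mu_{2i}/2\rfloor},$$ and let $\Psi_N=\sum_\mu\omega(\mu)z^{\ell(\mu)}$, summed over the strict partitions $\mu$ (including the empty one) with all parts $\le N$. **Theorem.** Let $a,b,c,d,z$ be nonzero complex numbers with $|a|,|b|,|c|,|d|<1$, put $q=abcd$, and assume $-abcz^2q^k\ne1$ for all $k\in\mathbb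 Z$. Then $(-a;q)_\infty$, $(-aq;q)_\infty$ and $(-abcz^2;q)_\infty$ are nonzero, and the following hold. (i) Assume $-az^2q^k\neq 1$ for all integers $k\ge1$. Put $X_N=\Psi_{2N}$ and, for $N\ge0$, $$F^X_N=(-abcz^2;q)_N\;{}_2\phi_1\left({q^{-N}z^{-2},\,-b^{-1}\atop -(abc)^{-1}q^{-N+1}z^{-2}};q,-c^{-1}q\right),$$ $$G^X_N=(ab)^N\frac{(qz^2,acz^2;q)_N}{(-aqz^2;q)_N}\;{}_2\phi_1\left({q^{N+1}z^2,\,-c^{-1}q\atop -aq^{N+1}z^2};q,-abc\right),$$ $$r^X_0={}_2\phi_1\left({z^{-2},-b^{-1}\atop -(abc)^{-1}z^{-2}q};q,-c^{-1}q\right),\qquad s^X_0={}_2\phi_1\left({z^2q,-c^{-1}q\atop -az^2q};q,-abc\right),$$ $$r^X_1=(1+abcz^2)\,{}_2\phi_1\left({z^{-2}q^{-1},-b^{-1}\atop -(abc)^{-1}z^{-2}};q,-c^{-1}q\right),$$ $$s^X_1=\frac{ab(1-z^2q)(1-acz^2)}{1+az^2q}\,{}_2\phi_1\left({z^2q^2,-c^{-1}q\atop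 -az^2q^2};q,-abc\right).$$ All these series have nonvanishing denominators and converge absolutely, and for every $N\ge0$ $$X_N=\frac{(-az^2q,-abc;q)_\infty}{(-a,-abcz^2;q)_\infty}\Big\{(s^X_0X_1-s^X_1X_0)F^X_N+(r^X_1X_0-r^X_0X_1)G^X_N\Big\}.$$ Moreover, for each $u$ with $u^2=ab$, both $Q_N=u^{-N}F^X_N$ and $Q_N=u^{-N}G^X_N$ satisfy the associated Al-Salam–Chihara recurrence $$(u+u^{-1})Q_n=Q_{n+1}+(\alpha+\beta)tq^nQ_n+(1-tq^n)(1-t\alpha\beta q^{n-1})Q_{n-1}\qquad(n\ge1)\qquad(*)$$ with $t=z^2$, $\alpha=-uc$, $\beta=-a/u$. (ii) Assume $-az^2q^k\neq 1$ for all integers $k\ge2$. Put $Y_N=\Psi_{2N+1}$ and, for $N\ge0$, $$F^Y_N=(-abcz^2;q)_N\;{}_2\phi_1\left({q^{-N}z^{-2},\,-acd\atop -(abc)^{-1}q^{-N+1}z^{-2}};q,-c^{-1}q\right),$$ $$G^Y_N=(ab)^N\frac{(qz^2,acqz^2;q)_N}{(-aq^2z^2;q)_N}\;{}_2\phi_1\left({q^{N+1}z^2,\,-c^{-1}q\atop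 -aq^{N+2}z^2};q,-abc\right),$$ $$r^Y_0={}_2\phi_1\left({z^{-2},-acd\atop -(abc)^{-1}qz^{-2}};q,-c^{-1}q\right),\qquad s^Y_0={}_2\phi_1\left({z^2q,-c^{-1}q\atop -aq^2z^2};q,-abc\right),$$ $$r^Y_1=(1+abcz^2)\,{}_2\phi_1\left({q^{-1}z^{-2},-acd\atop -(abc)^{-1}z^{-2}};q,-c^{-1}q\right),$$ $$s^Y_1=\frac{ab(1-z^2q)(1-acqz^2)}{1+aq^2z^2}\,{}_2\phi_1\left({z^2q^2,-c^{-1}q\atop -aq^3z^2};q,-abc\right).$$ All these series have nonvanishing denominators and converge absolutely, and for every $N\ge0$ $$Y_N=\frac{(-aq^2z^2,-abc;q)_\infty}{(-aq,-abcz^2;q)_\infty}\Big\{(s^Y_0Y_1-s^Y_1Y_0)F^Y_N+(r^Y_1Y_0-r^Y_0Y_1)G^Y_N\Big\}.$$ Moreover, for each $u$ with $u^2=ab$, both $Q_N=u^{-N}F^Y_N$ and $Q_N=u^{-N}G^Y_N$ satisfy $(*)$ with $t=z^2$, $\alpha=-uc$, $\beta=-aucd$. -/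

import Mathlib

/-- The strict partitions all of whose parts are at most `N`: a strict partition is the strictly
decreasing list of its (positive) parts, so it is obtained by sorting a subset of `{1, …, N}`. -/
def strictPartitions (N : ℕ) : Finset (List ℕ) :=
  (Finset.Icc 1 N).powerset.image fun s => s.sort (· ≥ ·)

theorem mem_strictPartitions {N : ℕ} {l : List ℕ} :
    l ∈ strictPartitions N ↔ l.Pairwise (· > ·) ∧ ∀ x ∈ l, 1 ≤ x ∧ x ≤ N := by
  unfold strictPartitions
  simp only [Finset.mem_image, Finset.mem_powerset]
  constructor
  · rintro ⟨s, hs, rfl⟩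
    refine ⟨(Finset.sortedGT_sort s).pairwise, fun x hx => ?_⟩
    exact Finset.mem_Icc.1 (hs ((Finset.mem_sort _).1 hx))
  · rintro ⟨hl, hx⟩
    have hnd : l.Nodup := hl.imp fun h => ne_of_gt h
    refine ⟨l.toFinset, fun x h => Finset.mem_Icc.2 (hx x (List.mem_toFinset.1 h)), ?_⟩
    exact (List.toFinset_sort (· ≥ ·) hnd).2 (hl.imp fun h => le_of_lt h)

/-- The Andrews–Stanley weight of a partition `l = (λ₁, λ₂, …)`, extended by zero parts. The list
is indexed from `0`, so `λ_{2i-1}` and `λ_{2i}` (`i ≥ 1`) are the entries `2i` and `2i+1` (`i ≥ 0`);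
`(m + 1) / 2` is the ceiling and `m / 2` the floor of half of `m`. -/
def omegaWeight {R : Type*} [CommSemiring R] (a b c d : R) (l : List ℕ) : R :=
  a ^ (∑ i ∈ Finset.range l.length, (l.getD (2 * i) 0 + 1) / 2) *
  b ^ (∑ i ∈ Finset.range l.length, l.getD (2 * i) 0 / 2) *
  c ^ (∑ i ∈ Finset.range l.length, (l.getD (2 * i + 1) 0 + 1) / 2) *
  d ^ (∑ i ∈ Finset.range l.length, l.getD (2 * i + 1) 0 / 2)

/-- The generating function `Ψ_N(a,b,c,d;z) = ∑ ω(μ) z^{ℓ(μ)}` over the strict partitions `μ` with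
parts at most `N`. -/
def Psi {R : Type*} [CommSemiring R] (a b c d z : R) (N : ℕ) : R :=
  ∑ l ∈ strictPartitions N, omegaWeight a b c d l * z ^ l.length

/-- The `q`-shifted factorial `(x;q)_n`. -/
noncomputable def qPoch (x q : ℂ) (n : ℕ) : ℂ := ∏ k ∈ Finset.range n, (1 - x * q ^ k)

/-- The infinite `q`-shifted factorial `(x;q)_∞`. -/
noncomputable def qPochInf (x q : ℂ) : ℂ := ∏' k : ℕ, (1 - x * q ^ k)

/-- The `n`-th term of the basic hypergeometric series `₂φ₁(A, B; C; q, x)`. -/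
noncomputable def phiTerm (A B C q x : ℂ) (n : ℕ) : ℂ :=
  qPoch A q n * qPoch B q n / (qPoch q q n * qPoch C q n) * x ^ n

/-- The sum of the basic hypergeometric series `₂φ₁(A, B; C; q, x)`. -/
noncomputable def phi (A B C q x : ℂ) : ℂ := ∑' n : ℕ, phiTerm A B C q x n

/-- `₂φ₁(A, B; C; q, x)` is well defined: no denominator vanishes and the series converges
absolutely. -/
def PhiConverges (A B C q x : ℂ) : Prop :=
  (∀ n : ℕ, qPoch q q n * qPoch C q n ≠ 0) ∧ Summable (phiTerm A B C q x)

/-- The associated Al-Salam–Chihara recurrence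
`2xQ_n = Q_{n+1} + (α+β)tqⁿQ_n + (1-tqⁿ)(1-tαβq^{n-1})Q_{n-1}` for `n ≥ 1`. -/
def AssocASCRecurrence (x α β t q : ℂ) (Q : ℕ → ℂ) : Prop :=
  ∀ n : ℕ, 2 * x * Q (n + 1) = Q (n + 2) + (α + β) * t * q ^ (n + 1) * Q (n + 1) +
    (1 - t * q ^ (n + 1)) * (1 - t * α * β * q ^ n) * Q n

/-! ### Infinite products and convergence of basic hypergeometric series. -/

open Filter Topology

/-! Deleting the largest part of a strict partition interchanges the roles of (a, b) and (c, d).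
Using this deletion repeatedly and eliminating the interchanged series gives three-term recurrences
for the even and odd subsequences (`Psi_even_rec`, `Psi_odd_rec`). The odd recurrence is the even
one with (a, b) replaced by (aq, b/q), so a single solution theory serves both parts.

The even recurrence is a contiguous relation of ₂φ₁ in which A and C are multiplied by q together
(`phi_contiguous`). Read downwards in N it gives the first solution F, read upwards the second
solution G (`solOne_rec`, `solTwo_rec`). A sequence satisfying the recurrence is fixed by its values
at 0 and 1, so Cramer's rule writes it in terms of F and G as soon as their Casoratian at 0 is known
and nonzero (`eq_of_rec`).

Removing from G the product accumulated by the last coefficient of the recurrence turns the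
Casoratian into an expression independent of n (`casoratian_eq`), which therefore equals its limit.
In the limit both ₂φ₁ degenerate to ₁φ₀ and are summed by the q-binomial theorem (`tendsto_phiOne`,
`tendsto_phiTwo`). The delicate point is domination for F, whose parameters grow like q^(-N); it
rests on `exists_norm_prod_phiOneRatio_le`. -/

theorem qPoch_zero (x q : ℂ) : qPoch x q 0 = 1 := by simp [qPoch]

theorem qPoch_succ (x q : ℂ) (n : ℕ) : qPoch x q (n + 1) = qPoch x q n * (1 - x * q ^ n) := by
  simp [qPoch, Finset.prod_range_succ]

theorem qPoch_succ' (x q : ℂ) (n : ℕ) : qPoch x q (n + 1) = (1 - x) * qPoch (x * q) q n := by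
  simp only [qPoch, Finset.prod_range_succ', pow_zero, mul_one]
  rw [mul_comm]
  congr 1
  exact Finset.prod_congr rfl fun k _ => by ring

theorem qPoch_ne_zero {x q : ℂ} (h : ∀ k : ℕ, 1 - x * q ^ k ≠ 0) (n : ℕ) : qPoch x q n ≠ 0 :=
  Finset.prod_ne_zero_iff.2 fun k _ => h k

theorem summable_norm_mul_pow {q : ℂ} (hq : ‖q‖ < 1) (x : ℂ) :
    Summable fun k : ℕ => ‖-(x * q ^ k)‖ := by
  simpa [norm_mul, norm_pow] using (summable_geometric_of_lt_one (norm_nonneg q) hq).mul_left ‖x‖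

theorem multipliable_one_sub_mul_pow {q : ℂ} (hq : ‖q‖ < 1) (x : ℂ) :
    Multipliable fun k : ℕ => 1 - x * q ^ k := by
  simpa [sub_eq_add_neg] using multipliable_one_add_of_summable (summable_norm_mul_pow hq x)

theorem tendsto_qPoch {q : ℂ} (hq : ‖q‖ < 1) (x : ℂ) :
    Tendsto (qPoch x q) atTop (𝓝 (qPochInf x q)) :=
  (multipliable_one_sub_mul_pow hq x).tendsto_prod_tprod_nat

theorem qPochInf_ne_zero {x q : ℂ} (hq : ‖q‖ < 1) (h : ∀ k : ℕ, 1 - x * q ^ k ≠ 0) :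
    qPochInf x q ≠ 0 := by
  have := tprod_one_add_ne_zero_of_summable (f := fun k : ℕ => -(x * q ^ k))
    (fun k => by simpa [sub_eq_add_neg] using h k) (summable_norm_mul_pow hq x)
  simpa [qPochInf, sub_eq_add_neg] using this

theorem one_sub_mul_pow_ne_zero {x q : ℂ} (hq : ‖q‖ < 1) (hx : ‖x‖ < 1) (k : ℕ) :
    1 - x * q ^ k ≠ 0 := by
  intro h
  have h1 : ‖x * q ^ k‖ < 1 := by
    rw [norm_mul, norm_pow]
    exact (mul_le_of_le_one_right (norm_nonneg x) (pow_le_one₀ (norm_nonneg q) hq.le)).trans_lt hx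
  rw [← sub_eq_zero.1 h] at h1
  simp at h1

theorem qPochInf_eq_mul {q : ℂ} (hq : ‖q‖ < 1) (x : ℂ) :
    qPochInf x q = (1 - x) * qPochInf (x * q) q := by
  refine tendsto_nhds_unique ((tendsto_add_atTop_iff_nat 1).2 (tendsto_qPoch hq x)) ?_
  simp only [qPoch_succ']
  exact (tendsto_qPoch hq (x * q)).const_mul _

theorem exists_norm_le_of_tendsto {f : ℕ → ℂ} {l : ℂ} (h : Tendsto f atTop (𝓝 l)) :
    ∃ K : ℝ, 0 ≤ K ∧ ∀ n, ‖f n‖ ≤ K := by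
  obtain ⟨K, hK⟩ := (Metric.isBounded_range_of_tendsto f h).exists_norm_le
  exact ⟨K, (norm_nonneg _).trans (hK (f 0) ⟨0, rfl⟩), fun n => hK _ ⟨n, rfl⟩⟩

/-- The coefficients of the series `₂φ₁`. -/
noncomputable def phiCoeff (A B C q : ℂ) (n : ℕ) : ℂ :=
  qPoch A q n * qPoch B q n / (qPoch q q n * qPoch C q n)

theorem one_sub_self_mul_pow_ne_zero {q : ℂ} (hq : ‖q‖ < 1) (k : ℕ) : 1 - q * q ^ k ≠ 0 :=
  one_sub_mul_pow_ne_zero hq hq k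

/-- Convergent coefficients are bounded, so |x| < 1 is enough for absolute convergence, whatever A
and B are. -/
theorem tendsto_phiCoeff {A B C q : ℂ} (hq : ‖q‖ < 1) (hC : ∀ k : ℕ, 1 - C * q ^ k ≠ 0) :
    Tendsto (phiCoeff A B C q) atTop
      (𝓝 (qPochInf A q * qPochInf B q / (qPochInf q q * qPochInf C q))) :=
  ((tendsto_qPoch hq A).mul (tendsto_qPoch hq B)).div
    ((tendsto_qPoch hq q).mul (tendsto_qPoch hq C))
    (mul_ne_zero (qPochInf_ne_zero hq (one_sub_self_mul_pow_ne_zero hq)) (qPochInf_ne_zero hq hC))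

theorem summable_mul_pow_of_tendsto {f : ℕ → ℂ} {l x : ℂ} (h : Tendsto f atTop (𝓝 l))
    (hx : ‖x‖ < 1) : Summable fun n => f n * x ^ n := by
  obtain ⟨K, -, hK⟩ := exists_norm_le_of_tendsto h
  refine Summable.of_norm_bounded (g := fun n => K * ‖x‖ ^ n)
    ((summable_geometric_of_lt_one (norm_nonneg x) hx).mul_left K) fun n => ?_
  rw [norm_mul, norm_pow]
  gcongr
  exact hK n

theorem phiConverges {A B C q x : ℂ} (hq : ‖q‖ < 1) (hx : ‖x‖ < 1)
    (hC : ∀ k : ℕ, 1 - C * q ^ k ≠ 0) : PhiConverges A B C q x :=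
  ⟨fun n => mul_ne_zero (qPoch_ne_zero (one_sub_self_mul_pow_ne_zero hq) n) (qPoch_ne_zero hC n),
    summable_mul_pow_of_tendsto (tendsto_phiCoeff hq hC) hx⟩

/-! ### Contiguous relation and q-binomial theorem. -/

/-- A three-term contiguous relation for `₂φ₁`. -/
theorem phi_contiguous {A B C q x : ℂ} (hq : ‖q‖ < 1) (hx : ‖x‖ < 1)
    (hC : ∀ k : ℕ, 1 - C * q ^ k ≠ 0) :
    x * (1 - A * q) * (B - C * q) * phi (A * q ^ 2) B (C * q ^ 2) q x =
      (q + x * B - C * q - A * q * x) * (1 - C * q) * phi (A * q) B (C * q) q x -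
        q * (1 - C) * (1 - C * q) * phi A B C q x := by
  have hC1 : ∀ k : ℕ, 1 - C * q * q ^ k ≠ 0 := fun k => by
    have := hC (k + 1); rwa [pow_succ', ← mul_assoc] at this
  have hC2 : ∀ k : ℕ, 1 - C * q ^ 2 * q ^ k ≠ 0 := fun k => by
    have := hC (k + 2); rwa [pow_add, mul_comm (q ^ k), ← mul_assoc] at this
  have hc0 : 1 - C ≠ 0 := by simpa using hC 0
  have hc1 : 1 - C * q ≠ 0 := by simpa using hC 1
  have s0 := (phiConverges (A := A) (B := B) hq hx hC).2
  have s1 := (phiConverges (A := A * q) (B := B) hq hx hC1).2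
  have s2 := (phiConverges (A := A * q ^ 2) (B := B) hq hx hC2).2
  -- Telescoping certificate: the relation holds termwise up to G (n + 1) - G n. The truncated n - 1
  -- is harmless at n = 0, where the factor 1 - q ^ n vanishes; hence also G 0 = 0.
  set G : ℕ → ℂ := fun n => q * (A - C) * (1 - C) * (1 - C * q) * (1 - q ^ n) *
    (qPoch (A * q) q (n - 1) * qPoch B q n / (qPoch q q n * qPoch C q (n + 1))) * x ^ n with hG
  have hstep : ∀ n, x * (1 - A * q) * (B - C * q) * phiTerm (A * q ^ 2) B (C * q ^ 2) q x n -
      ((q + x * B - C * q - A * q * x) * (1 - C * q) * phiTerm (A * q) B (C * q) q x n -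
        q * (1 - C) * (1 - C * q) * phiTerm A B C q x n) = G (n + 1) - G n := by
    intro n
    have e1 : qPoch (C * q) q n = qPoch C q n * (1 - C * q ^ n) / (1 - C) := by
      rw [eq_div_iff hc0, ← qPoch_succ, qPoch_succ', mul_comm]
    have e2 : qPoch (C * q ^ 2) q n =
        qPoch C q n * (1 - C * q ^ n) * (1 - C * q ^ (n + 1)) / ((1 - C) * (1 - C * q)) := by
      rw [eq_div_iff (mul_ne_zero hc0 hc1), ← qPoch_succ, ← qPoch_succ, qPoch_succ', qPoch_succ',
        sq, ← mul_assoc C q q]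
      ring
    have hCn := hC n
    have hCn1 := hC (n + 1)
    have hQ := qPoch_ne_zero (one_sub_self_mul_pow_ne_zero hq) n
    have hqn : 1 - q * q ^ n ≠ 0 := one_sub_self_mul_pow_ne_zero hq n
    have hP := qPoch_ne_zero hC n
    have e3 : (1 - A * q) * qPoch (A * q ^ 2) q n = qPoch (A * q) q n * (1 - A * q * q ^ n) := by
      rw [← qPoch_succ, qPoch_succ', sq, ← mul_assoc]
    have t2 : x * (1 - A * q) * (B - C * q) * phiTerm (A * q ^ 2) B (C * q ^ 2) q x n =
        x * (B - C * q) * (1 - C) * (1 - C * q) * qPoch (A * q) q n * (1 - A * q * q ^ n) *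
          qPoch B q n * x ^ n / (qPoch q q n * (qPoch C q n * (1 - C * q ^ n) *
            (1 - C * q ^ (n + 1)))) := by
      rw [phiTerm, e2]
      field_simp
      linear_combination (x * (B - C * q) * qPoch B q n * x ^ n * (1 - C * q)) * e3
    rw [t2]
    simp only [hG, phiTerm, e1, qPoch_succ, Nat.add_sub_cancel]
    rw [pow_succ q n, pow_succ x n]
    have hCn1' : 1 - C * q * q ^ n ≠ 0 := hC1 n
    rw [show C * (q ^ n * q) = C * q * q ^ n by ring]
    rcases n with _ | n
    · simp only [qPoch_zero, pow_zero, mul_one, one_mul] at *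
      field_simp
      ring
    · rw [qPoch_succ' A, Nat.add_sub_cancel, qPoch_succ (A * q)]
      generalize qPoch (A * q) q n = P1 at *
      generalize qPoch B q (n + 1) = P2 at *
      generalize qPoch q q (n + 1) = P3 at *
      generalize qPoch C q (n + 1) = P4 at *
      rw [show A * q * q ^ n = A * q ^ (n + 1) by ring]
      generalize q ^ (n + 1) = Z at *
      generalize x ^ (n + 1) = Y at *
      field_simp
      ring
  have hlim : Tendsto G atTop (𝓝 0) := by
    have h1 : Tendsto (fun n : ℕ => qPoch (A * q) q (n - 1)) atTop (𝓝 (qPochInf (A * q) q)) :=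
      (tendsto_qPoch hq _).comp (tendsto_sub_atTop_nat 1)
    have h2 := ((tendsto_pow_atTop_nhds_zero_of_norm_lt_one hq).const_sub 1)
    have h3 := (h1.mul (tendsto_qPoch hq B)).div ((tendsto_qPoch hq q).mul
      ((tendsto_add_atTop_iff_nat 1).2 (tendsto_qPoch hq C)))
      (mul_ne_zero (qPochInf_ne_zero hq (one_sub_self_mul_pow_ne_zero hq))
        (qPochInf_ne_zero hq hC))
    have h4 := ((h2.const_mul (q * (A - C) * (1 - C) * (1 - C * q))).mul h3).mul
      (tendsto_pow_atTop_nhds_zero_of_norm_lt_one hx)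
    simpa using h4
  have hsum := ((s2.mul_left (x * (1 - A * q) * (B - C * q))).sub
    ((s1.mul_left ((q + x * B - C * q - A * q * x) * (1 - C * q))).sub
      (s0.mul_left (q * (1 - C) * (1 - C * q)))))
  have hT := hsum.hasSum.tendsto_sum_nat
  simp only [hstep, Finset.sum_range_sub] at hT
  have hG0 : G 0 = 0 := by simp [hG]
  rw [hG0] at hT
  have hz := tendsto_nhds_unique hT (by simpa using hlim)
  simp only [← hstep] at hz
  rw [(s2.mul_left _).tsum_sub ((s1.mul_left _).sub (s0.mul_left _)),
    (s1.mul_left _).tsum_sub (s0.mul_left _), tsum_mul_left, tsum_mul_left, tsum_mul_left] at hz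
  exact sub_eq_zero.1 hz

/-- The `q`-binomial theorem. -/
theorem tsum_q_binomial {A q x : ℂ} (hq : ‖q‖ < 1) (hx : ‖x‖ < 1) :
    ∑' n : ℕ, qPoch A q n / qPoch q q n * x ^ n = qPochInf (A * x) q / qPochInf x q := by
  have hQ := one_sub_self_mul_pow_ne_zero hq
  have hc : Tendsto (fun n => qPoch A q n / qPoch q q n) atTop
      (𝓝 (qPochInf A q / qPochInf q q)) :=
    (tendsto_qPoch hq A).div (tendsto_qPoch hq q) (qPochInf_ne_zero hq hQ)
  set c : ℕ → ℂ := fun n => qPoch A q n / qPoch q q n with hcdef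
  have hc0 : c 0 = 1 := by simp [hcdef, qPoch_zero]
  have hrec : ∀ n, c (n + 1) * (1 - q ^ (n + 1)) = c n * (1 - A * q ^ n) := fun n => by
    have h1 := qPoch_ne_zero hQ n
    have h2 := hQ n
    simp only [hcdef, qPoch_succ]
    rw [pow_succ']
    generalize q * q ^ n = Z at *
    field_simp
  set f : ℂ → ℂ := fun y => ∑' n : ℕ, c n * y ^ n with hf
  have hs : ∀ y : ℂ, ‖y‖ < 1 → Summable fun n => c n * y ^ n := fun y hy =>
    summable_mul_pow_of_tendsto hc hy
  -- The recursion of the coefficients becomes a q-difference equation for the sum; iterating it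
  -- pushes the argument to 0, where the sum is 1.
  have hfun : ∀ y : ℂ, ‖y‖ < 1 → (1 - y) * f y = (1 - A * y) * f (q * y) := by
    intro y hy
    have hqy : ‖q * y‖ < 1 := by
      rw [norm_mul]; exact mul_lt_one_of_nonneg_of_lt_one_left (norm_nonneg _) hq hy.le
    have s1 := hs y hy
    have s2 := hs _ hqy
    have e1 : f y = 1 + ∑' n : ℕ, c (n + 1) * y ^ (n + 1) := by
      simp only [hf]; rw [s1.tsum_eq_zero_add]; simp [hc0]
    have e2 : f (q * y) = 1 + ∑' n : ℕ, c (n + 1) * (q * y) ^ (n + 1) := by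
      simp only [hf]; rw [s2.tsum_eq_zero_add]; simp [hc0]
    have s1' := (summable_nat_add_iff 1).2 s1
    have s2' := (summable_nat_add_iff 1).2 s2
    have e3 : f y - f (q * y) = y * f y - A * y * f (q * y) := by
      rw [e1, e2, add_sub_add_left_eq_sub, ← s1'.tsum_sub s2', ← e1, ← e2]
      simp only [hf]
      rw [← tsum_mul_left, ← tsum_mul_left, ← (s1.mul_left _).tsum_sub (s2.mul_left _)]
      refine tsum_congr fun n => ?_
      linear_combination (y ^ (n + 1)) * hrec n
    linear_combination e3
  have hnorm : ∀ n : ℕ, ‖q ^ n * x‖ < 1 := fun n => by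
    rw [norm_mul, norm_pow]
    exact (mul_le_of_le_one_left (norm_nonneg _) (pow_le_one₀ (norm_nonneg q) hq.le)).trans_lt hx
  have hiter : ∀ n, qPoch x q n * f x = qPoch (A * x) q n * f (q ^ n * x) := by
    intro n
    induction n with
    | zero => simp [qPoch_zero]
    | succ n ih =>
      have h := hfun _ (hnorm n)
      rw [qPoch_succ, qPoch_succ, pow_succ' q n, mul_assoc q]
      linear_combination (1 - x * q ^ n) * ih + qPoch (A * x) q n * h
  have hf1 : Tendsto (fun n : ℕ => f (q ^ n * x)) atTop (𝓝 1) := by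
    obtain ⟨K, hK0, hK⟩ := exists_norm_le_of_tendsto hc
    have := tendsto_tsum_of_dominated_convergence (𝓕 := atTop)
      (f := fun (n : ℕ) (k : ℕ) => c k * (q ^ n * x) ^ k) (g := fun k => if k = 0 then 1 else 0)
      (bound := fun k => K * ‖x‖ ^ k)
      ((summable_geometric_of_lt_one (norm_nonneg x) hx).mul_left K) (fun k => ?_)
      (Eventually.of_forall fun n k => ?_)
    · simpa [hf] using this
    · rcases eq_or_ne k 0 with rfl | hk
      · simp [hc0]
      · have h := (((tendsto_pow_atTop_nhds_zero_of_norm_lt_one hq).mul_const x).pow k).const_mul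
          (c k)
        simpa [hk] using h
    · rw [norm_mul, norm_pow]
      gcongr
      · exact hK k
      · rw [norm_mul, norm_pow]
        exact mul_le_of_le_one_left (norm_nonneg _) (pow_le_one₀ (norm_nonneg q) hq.le)
  have hx0 := qPochInf_ne_zero hq (one_sub_mul_pow_ne_zero hq hx)
  rw [eq_div_iff hx0, mul_comm]
  have h := ((tendsto_qPoch hq (A * x)).mul hf1).congr fun n => (hiter n).symm
  rw [mul_one] at h
  exact tendsto_nhds_unique ((tendsto_qPoch hq x).mul_const _) h

/-! ### The two hypergeometric solutions of the recurrence. -/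

/-- The parameters `a, b, c, d, t` (with `q = abcd`) are such that both basic hypergeometric
solutions of the associated Al-Salam–Chihara recurrence are defined. -/
structure ASCParams (a b c d q t : ℂ) : Prop where
  a_ne : a ≠ 0
  b_ne : b ≠ 0
  c_ne : c ≠ 0
  d_ne : d ≠ 0
  t_ne : t ≠ 0
  q_eq : q = a * b * c * d
  q_lt : ‖q‖ < 1
  ab_lt : ‖a * b‖ < 1
  abc_lt : ‖a * b * c‖ < 1
  d_lt : ‖d‖ < 1
  abd_lt : ‖a * b * d‖ < 1
  w_ne : ∀ k : ℤ, 1 + a * b * c * t * q ^ k ≠ 0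
  at_ne : ∀ k : ℕ, 1 ≤ k → 1 + a * t * q ^ k ≠ 0

/-- The series in the first solution. -/
noncomputable def phiOne (a b c q t : ℂ) (N : ℕ) : ℂ :=
  phi (q ^ (-(N : ℤ)) * t⁻¹) (-b⁻¹) (-(a * b * c)⁻¹ * q ^ (-(N : ℤ) + 1) * t⁻¹) q (-c⁻¹ * q)

/-- The series in the second solution. -/
noncomputable def phiTwo (a b c q t : ℂ) (N : ℕ) : ℂ :=
  phi (q ^ (N + 1) * t) (-c⁻¹ * q) (-(a * q ^ (N + 1) * t)) q (-(a * b * c))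

/-- The first solution. -/
noncomputable def solOne (a b c q t : ℂ) (N : ℕ) : ℂ :=
  qPoch (-(a * b * c * t)) q N * phiOne a b c q t N

/-- The second solution. -/
noncomputable def solTwo (a b c q t : ℂ) (N : ℕ) : ℂ :=
  (a * b) ^ N * (qPoch (q * t) q N * qPoch (a * c * t) q N / qPoch (-(a * q * t)) q N) *
    phiTwo a b c q t N

/-- The second solution without the factors that may vanish. -/
noncomputable def solTwoReduced (a b c q t : ℂ) (N : ℕ) : ℂ :=
  phiTwo a b c q t N / qPoch (-(a * q * t)) q N

namespace ASCParams

variable {a b c d q t : ℂ}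

theorem q_ne (h : ASCParams a b c d q t) : q ≠ 0 := by
  rw [h.q_eq]
  exact mul_ne_zero (mul_ne_zero (mul_ne_zero h.a_ne h.b_ne) h.c_ne) h.d_ne

theorem x_lt (h : ASCParams a b c d q t) : ‖-c⁻¹ * q‖ < 1 := by
  have : -c⁻¹ * q = -(a * b * d) := by
    have := h.c_ne
    rw [h.q_eq]; field_simp
  rw [this, norm_neg]
  exact h.abd_lt

theorem one_sub_phiOne_denom (h : ASCParams a b c d q t) (j : ℤ) (k : ℕ) :
    1 - -(a * b * c)⁻¹ * q ^ j * t⁻¹ * q ^ k ≠ 0 := by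
  have hq := h.q_ne
  have ha := h.a_ne
  have hb := h.b_ne
  have hc := h.c_ne
  have ht := h.t_ne
  have hw := h.w_ne (-(j + k))
  intro h0
  apply hw
  rw [zpow_neg, zpow_add₀ hq, zpow_natCast]
  have hj := zpow_ne_zero j hq
  have hk := pow_ne_zero k hq
  field_simp at h0 ⊢
  linear_combination h0

theorem one_sub_phiTwo_denom (h : ASCParams a b c d q t) (n k : ℕ) :
    1 - -(a * q ^ (n + 1) * t) * q ^ k ≠ 0 := by
  have := h.at_ne (n + 1 + k) (by omega)
  rw [pow_add] at this
  intro h0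
  apply this
  linear_combination h0

theorem one_sub_at (h : ASCParams a b c d q t) (k : ℕ) : 1 - -(a * q * t) * q ^ k ≠ 0 := by
  simpa using h.one_sub_phiTwo_denom 0 k

theorem one_sub_w (h : ASCParams a b c d q t) (k : ℕ) :
    1 - -(a * b * c * t) * q ^ k ≠ 0 := by
  simpa [sub_eq_add_neg] using h.w_ne k

theorem phiConverges_phiOne (h : ASCParams a b c d q t) (N : ℕ) :
    PhiConverges (q ^ (-(N : ℤ)) * t⁻¹) (-b⁻¹) (-(a * b * c)⁻¹ * q ^ (-(N : ℤ) + 1) * t⁻¹) q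
      (-c⁻¹ * q) :=
  phiConverges h.q_lt h.x_lt (h.one_sub_phiOne_denom _)

theorem phiConverges_phiTwo (h : ASCParams a b c d q t) (N : ℕ) :
    PhiConverges (q ^ (N + 1) * t) (-c⁻¹ * q) (-(a * q ^ (N + 1) * t)) q (-(a * b * c)) :=
  phiConverges h.q_lt (by rw [norm_neg]; exact h.abc_lt) (h.one_sub_phiTwo_denom _)

/-- In `phi_contiguous` take A and C of index n + 2; each multiplication by q lowers the index by
one. The factors 1 - C and 1 - C * q become, up to monomials, the new factors of (-abct; q)_N, and B
- C * q supplies 1 - a * c * t * q ^ n. -/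
theorem solOne_rec (h : ASCParams a b c d q t) (n : ℕ) :
    solOne a b c q t (n + 2) =
      (1 + a * b + a * (1 + b * c) * t * q ^ (n + 1)) * solOne a b c q t (n + 1) -
        a * b * (1 - t * q ^ (n + 1)) * (1 - a * c * t * q ^ n) * solOne a b c q t n := by
  have hq := h.q_ne
  have ha := h.a_ne
  have hb := h.b_ne
  have hc := h.c_ne
  have ht := h.t_ne
  have hqn := pow_ne_zero n hq
  have key := phi_contiguous (A := q ^ (-((n + 2 : ℕ) : ℤ)) * t⁻¹) (B := -b⁻¹)
    (C := -(a * b * c)⁻¹ * q ^ (-((n + 2 : ℕ) : ℤ) + 1) * t⁻¹) h.q_lt h.x_lt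
    (h.one_sub_phiOne_denom _)
  have z1 : q ^ (-((n + 2 : ℕ) : ℤ)) = (q ^ n * q ^ 2)⁻¹ := by
    rw [zpow_neg, zpow_natCast, pow_add]
  have z2 : q ^ (-((n + 1 : ℕ) : ℤ)) = (q ^ n * q)⁻¹ := by
    rw [zpow_neg, zpow_natCast, pow_succ]
  have z3 : q ^ (-(n : ℤ)) = (q ^ n)⁻¹ := by rw [zpow_neg, zpow_natCast]
  have p2 : phi (q ^ (-((n + 2 : ℕ) : ℤ)) * t⁻¹) (-b⁻¹)
      (-(a * b * c)⁻¹ * q ^ (-((n + 2 : ℕ) : ℤ) + 1) * t⁻¹) q (-c⁻¹ * q) =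
      phiOne a b c q t (n + 2) := rfl
  have p1 : phi (q ^ (-((n + 2 : ℕ) : ℤ)) * t⁻¹ * q) (-b⁻¹)
      (-(a * b * c)⁻¹ * q ^ (-((n + 2 : ℕ) : ℤ) + 1) * t⁻¹ * q) q (-c⁻¹ * q) =
      phiOne a b c q t (n + 1) := by
    rw [phiOne, zpow_add_one₀ hq, zpow_add_one₀ hq, z1, z2]
    congr 1 <;> field_simp
  have p0 : phi (q ^ (-((n + 2 : ℕ) : ℤ)) * t⁻¹ * q ^ 2) (-b⁻¹)
      (-(a * b * c)⁻¹ * q ^ (-((n + 2 : ℕ) : ℤ) + 1) * t⁻¹ * q ^ 2) q (-c⁻¹ * q) =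
      phiOne a b c q t n := by
    rw [phiOne, zpow_add_one₀ hq, zpow_add_one₀ hq, z1, z3]
    congr 1 <;> field_simp
  rw [p2, p1, p0, zpow_add_one₀ hq, z1] at key
  simp only [solOne, qPoch_succ]
  generalize phiOne a b c q t (n + 2) = f2 at *
  generalize phiOne a b c q t (n + 1) = f1 at *
  generalize phiOne a b c q t n = f0 at *
  generalize qPoch (-(a * b * c * t)) q n = P at *
  rw [pow_succ]
  generalize q ^ n = Z at *
  field_simp at key ⊢
  linear_combination P * key

/-- Here multiplying A and C by q raises the index, so the contiguous relation gives the recurrence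
with its variable coefficient on the highest term. This form is what makes the Casoratian expression
constant without dividing by factors that may vanish. -/
theorem solTwoReduced_rec (h : ASCParams a b c d q t) (n : ℕ) :
    a * b * (1 - t * q ^ (n + 2)) * (1 - a * c * t * q ^ (n + 1)) *
        solTwoReduced a b c q t (n + 2) =
      (1 + a * b + a * (1 + b * c) * t * q ^ (n + 1)) * solTwoReduced a b c q t (n + 1) -
        solTwoReduced a b c q t n := by
  have hq := h.q_ne
  have hc := h.c_ne
  have key := phi_contiguous (A := q ^ (n + 1) * t) (B := -c⁻¹ * q) (C := -(a * q ^ (n + 1) * t))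
    (x := -(a * b * c)) h.q_lt (by rw [norm_neg]; exact h.abc_lt) (h.one_sub_phiTwo_denom _)
  have p1 : phi (q ^ (n + 1) * t * q) (-c⁻¹ * q) (-(a * q ^ (n + 1) * t) * q) q (-(a * b * c)) =
      phiTwo a b c q t (n + 1) := by
    rw [phiTwo, pow_succ q (n + 1)]; congr 1 <;> ring
  have p2 : phi (q ^ (n + 1) * t * q ^ 2) (-c⁻¹ * q) (-(a * q ^ (n + 1) * t) * q ^ 2) q
      (-(a * b * c)) = phiTwo a b c q t (n + 2) := by
    rw [phiTwo, show n + 2 + 1 = n + 1 + 2 by rfl, pow_add q (n + 1) 2]; congr 1 <;> ring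
  have p0 : phi (q ^ (n + 1) * t) (-c⁻¹ * q) (-(a * q ^ (n + 1) * t)) q (-(a * b * c)) =
      phiTwo a b c q t n := rfl
  rw [p2, p1, p0] at key
  have d0 := h.one_sub_at n
  have d1 := h.one_sub_at (n + 1)
  have dP := qPoch_ne_zero h.one_sub_at n
  simp only [solTwoReduced, qPoch_succ]
  generalize phiTwo a b c q t (n + 2) = f2 at *
  generalize phiTwo a b c q t (n + 1) = f1 at *
  generalize phiTwo a b c q t n = f0 at *
  generalize qPoch (-(a * q * t)) q n = P at *
  have key2 : a * b * (1 - t * q ^ (n + 2)) * (1 - a * c * t * q ^ (n + 1)) * f2 =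
      (1 + a * b + a * (1 + b * c) * t * q ^ (n + 1)) * (1 - -(a * q * t) * q ^ (n + 1)) * f1 -
        (1 - -(a * q * t) * q ^ n) * (1 - -(a * q * t) * q ^ (n + 1)) * f0 := by
    refine mul_left_cancel₀ hq ?_
    rw [pow_succ q (n + 1), pow_succ] at *
    generalize q ^ n = Z at *
    field_simp at key ⊢
    linear_combination key
  generalize 1 - -(a * q * t) * q ^ n = D0 at *
  generalize 1 - -(a * q * t) * q ^ (n + 1) = D1 at *
  generalize 1 + a * b + a * (1 + b * c) * t * q ^ (n + 1) = u at *
  generalize a * b * (1 - t * q ^ (n + 2)) * (1 - a * c * t * q ^ (n + 1)) = v at *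
  field_simp
  linear_combination key2

theorem solTwo_eq (n : ℕ) : solTwo a b c q t n =
    (a * b) ^ n * (qPoch (q * t) q n * qPoch (a * c * t) q n) * solTwoReduced a b c q t n := by
  rw [solTwo, solTwoReduced]; ring

/-- The reduced recurrence is multiplied by the removed product at index n + 1, so nothing is lost
if that product is zero. -/
theorem solTwo_rec (h : ASCParams a b c d q t) (n : ℕ) :
    solTwo a b c q t (n + 2) =
      (1 + a * b + a * (1 + b * c) * t * q ^ (n + 1)) * solTwo a b c q t (n + 1) -
        a * b * (1 - t * q ^ (n + 1)) * (1 - a * c * t * q ^ n) * solTwo a b c q t n := by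
  have key := h.solTwoReduced_rec n
  simp only [solTwo_eq, qPoch_succ]
  linear_combination ((a * b) ^ (n + 1) * (qPoch (q * t) q n * (1 - q * t * q ^ n)) *
    (qPoch (a * c * t) q n * (1 - a * c * t * q ^ n))) * key

/-- The Casoratian of the two solutions, up to a product. -/
theorem casoratian_eq (h : ASCParams a b c d q t) (n : ℕ) :
    solOne a b c q t (n + 1) * solTwoReduced a b c q t n -
        a * b * (1 - t * q ^ (n + 1)) * (1 - a * c * t * q ^ n) * solOne a b c q t n *
          solTwoReduced a b c q t (n + 1) =
      solOne a b c q t 1 * solTwo a b c q t 0 - solOne a b c q t 0 * solTwo a b c q t 1 := by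
  induction n with
  | zero => simp [solTwo_eq, qPoch_succ, qPoch_zero]; ring
  | succ n ih =>
    rw [← ih]
    linear_combination solTwoReduced a b c q t (n + 1) * h.solOne_rec n -
      solOne a b c q t (n + 1) * h.solTwoReduced_rec n

/-- The parameters carrying q ^ (N + 1) tend to 0, which leaves ₁φ₀(-q/c; -abc). Dominated
convergence applies because the N-dependent factors are bounded uniformly in N and n. -/
theorem tendsto_phiTwo (h : ASCParams a b c d q t) :
    Tendsto (phiTwo a b c q t) atTop
      (𝓝 (qPochInf (a * b * q) q / qPochInf (-(a * b * c)) q)) := by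
  have hq := h.q_lt
  have hx : ‖-(a * b * c)‖ < 1 := by rw [norm_neg]; exact h.abc_lt
  have hA : -c⁻¹ * q * -(a * b * c) = a * b * q := by
    have := h.c_ne
    field_simp
  rw [← hA, ← tsum_q_binomial hq hx]
  have split : ∀ (y : ℂ) (N n : ℕ), qPoch (y * q) q (N + n) =
      qPoch (y * q) q N * qPoch (y * q ^ (N + 1)) q n := by
    intro y N n
    simp only [qPoch, Finset.prod_range_add]
    congr 1
    exact Finset.prod_congr rfl fun k _ => by ring
  have hC : ∀ k, 1 - -(a * t) * q * q ^ k ≠ 0 := fun k => by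
    have := h.one_sub_at k
    rwa [show -(a * t) * q = -(a * q * t) by ring]
  have e : ∀ N n, qPoch (q ^ (N + 1) * t) q n = qPoch (t * q ^ (N + 1)) q n := fun N n => by
    rw [mul_comm]
  have e' : ∀ N n, qPoch (-(a * q ^ (N + 1) * t)) q n =
      qPoch (-(a * t) * q ^ (N + 1)) q n := fun N n => by
    congr 1; ring
  have hq1 : ∀ N n : ℕ, ∀ y : ℂ, ‖qPoch (y * q ^ (N + 1)) q n‖ ≤
      Real.exp (∑' k : ℕ, ‖y * q ^ k‖) := by
    intro N n y
    have hs : Summable fun k : ℕ => ‖y * q ^ k‖ := by simpa using summable_norm_mul_pow hq y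
    rw [qPoch, norm_prod]
    calc ∏ k ∈ Finset.range n, ‖1 - y * q ^ (N + 1) * q ^ k‖
        ≤ ∏ k ∈ Finset.range n, (1 + ‖y * q ^ k‖) := by
          refine Finset.prod_le_prod (fun _ _ => norm_nonneg _) fun k _ => ?_
          refine (norm_sub_le _ _).trans ?_
          rw [norm_one, mul_right_comm, norm_mul (y * q ^ k), norm_pow]
          gcongr
          exact mul_le_of_le_one_right (norm_nonneg _) (pow_le_one₀ (norm_nonneg q) hq.le)
      _ ≤ Real.exp (∑ k ∈ Finset.range n, ‖y * q ^ k‖) :=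
          Real.prod_one_add_le_exp_sum _ fun _ => norm_nonneg _
      _ ≤ _ := Real.exp_le_exp.2 (hs.sum_le_tsum _ fun _ _ => norm_nonneg _)
  obtain ⟨K1, hK10, hK1⟩ := exists_norm_le_of_tendsto (tendsto_qPoch hq (-(a * t) * q))
  obtain ⟨K2, hK20, hK2⟩ := exists_norm_le_of_tendsto
    ((tendsto_qPoch hq (-(a * t) * q)).inv₀ (qPochInf_ne_zero hq hC))
  obtain ⟨K3, hK30, hK3⟩ := exists_norm_le_of_tendsto
    ((tendsto_qPoch hq (-c⁻¹ * q)).div (tendsto_qPoch hq q)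
      (qPochInf_ne_zero hq (one_sub_self_mul_pow_ne_zero hq)))
  set M := Real.exp (∑' k : ℕ, ‖t * q ^ k‖)
  have hform : ∀ N n, phiTerm (q ^ (N + 1) * t) (-c⁻¹ * q) (-(a * q ^ (N + 1) * t)) q
      (-(a * b * c)) n = qPoch (t * q ^ (N + 1)) q n * (qPoch (-(a * t) * q ^ (N + 1)) q n)⁻¹ *
        (qPoch (-c⁻¹ * q) q n / qPoch q q n) * (-(a * b * c)) ^ n := fun N n => by
    rw [phiTerm, e, e', div_eq_mul_inv, div_eq_mul_inv, mul_inv]; ring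
  -- The shifted denominator is a quotient of two factorials with a fixed base, each bounded above
  -- and away from 0; this bounds its inverse uniformly.
  have hinv : ∀ N n, (qPoch (-(a * t) * q ^ (N + 1)) q n)⁻¹ =
      qPoch (-(a * t) * q) q N * (qPoch (-(a * t) * q) q (N + n))⁻¹ := fun N n => by
    rw [split, mul_inv, mul_inv_cancel_left₀ (qPoch_ne_zero hC N)]
  have hpow : Tendsto (fun N : ℕ => q ^ (N + 1)) atTop (𝓝 0) :=
    (tendsto_add_atTop_iff_nat 1).2 (tendsto_pow_atTop_nhds_zero_of_norm_lt_one hq)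
  have hone : ∀ (y : ℂ) (n : ℕ), Tendsto (fun N => qPoch (y * q ^ (N + 1)) q n) atTop (𝓝 1) := by
    intro y n
    have : Tendsto (fun N : ℕ => ∏ k ∈ Finset.range n, (1 - y * q ^ (N + 1) * q ^ k)) atTop
        (𝓝 (∏ k ∈ Finset.range n, (1 - y * 0 * q ^ k))) :=
      tendsto_finsetProd _ fun k _ => ((hpow.const_mul y).mul_const _).const_sub 1
    simpa [qPoch] using this
  refine tendsto_tsum_of_dominated_convergence
    (bound := fun n => M * (K1 * K2) * K3 * ‖-(a * b * c)‖ ^ n)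
    ((summable_geometric_of_lt_one (norm_nonneg _) hx).mul_left _) (fun n => ?_)
    (Eventually.of_forall fun N n => ?_)
  · simp only [hform]
    have := (((hone t n).mul ((hone (-(a * t)) n).inv₀ one_ne_zero)).mul_const
      (qPoch (-c⁻¹ * q) q n / qPoch q q n)).mul_const ((-(a * b * c)) ^ n)
    simpa using this
  · rw [hform, hinv, norm_mul, norm_mul, norm_mul, norm_mul (qPoch _ _ _) (_)⁻¹, norm_pow]
    gcongr
    · exact hq1 N n t
    · exact hK1 N
    · exact hK2 (N + n)
    · exact hK3 n

end ASCParams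

/-! ### Generating functions of strict partitions. -/

theorem Finset.sort_ge_insert {N : ℕ} {s : Finset ℕ} (hs : s ⊆ Finset.Icc 1 N) :
    (insert (N + 1) s).sort (· ≥ ·) = (N + 1) :: s.sort (· ≥ ·) := by
  have h : ∀ x ∈ s, x ≤ N := fun x hx => (Finset.mem_Icc.1 (hs hx)).2
  exact Finset.sort_insert _ (fun x hx => (h x hx).trans (Nat.le_succ N))
    fun hx => absurd (h _ hx) (by omega)

/-- Prepending a part shifts all positions by one, so odd- and even-placed parts trade weights. -/
theorem omegaWeight_cons {R : Type*} [CommSemiring R] (a b c d : R) (m : ℕ) (l : List ℕ) :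
    omegaWeight a b c d (m :: l) = a ^ ((m + 1) / 2) * b ^ (m / 2) * omegaWeight c d a b l := by
  have key : ∀ f : ℕ → ℕ, ∑ i ∈ Finset.range (l.length + 1), f ((m :: l).getD (2 * i) 0) =
      f m + ∑ i ∈ Finset.range l.length, f (l.getD (2 * i + 1) 0) := by
    intro f
    rw [Finset.sum_range_succ', add_comm]
    simp [mul_add]
  have key' : ∀ f : ℕ → ℕ, f 0 = 0 →
      ∑ i ∈ Finset.range (l.length + 1), f ((m :: l).getD (2 * i + 1) 0) =
        ∑ i ∈ Finset.range l.length, f (l.getD (2 * i) 0) := by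
    intro f hf
    -- The last summand reads an entry beyond the end of the list, so it is f 0 = 0.
    rw [Finset.sum_range_succ, add_eq_left.2]
    · simp
    · rw [List.getD_eq_default _ _ (by simp; omega), hf]
  simp only [omegaWeight, List.length_cons]
  rw [key fun x => (x + 1) / 2, key fun x => x / 2, key' (fun x => (x + 1) / 2) rfl,
    key' (fun x => x / 2) rfl, pow_add, pow_add]
  ring

theorem Psi_eq_sum_powerset {R : Type*} [CommSemiring R] (a b c d z : R) (N : ℕ) :
    Psi a b c d z N = ∑ s ∈ (Finset.Icc 1 N).powerset,
      omegaWeight a b c d (s.sort (· ≥ ·)) * z ^ s.card := by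
  rw [Psi, strictPartitions, Finset.sum_image]
  · simp
  · intro s _ t _ h
    have := congrArg List.toFinset h
    simpa using this

/-- Removing the part `N + 1` from the strict partitions that contain it. -/
theorem Psi_succ {R : Type*} [CommSemiring R] (a b c d z : R) (N : ℕ) :
    Psi a b c d z (N + 1) =
      Psi a b c d z N + z * a ^ ((N + 2) / 2) * b ^ ((N + 1) / 2) * Psi c d a b z N := by
  have hN : N + 1 ∉ Finset.Icc 1 N := by simp
  rw [Psi_eq_sum_powerset, ← Finset.insert_Icc_right_eq_Icc_add_one (by omega),
    Finset.sum_powerset_insert hN, ← Psi_eq_sum_powerset, Psi_eq_sum_powerset c, Finset.mul_sum]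
  congr 1
  refine Finset.sum_congr rfl fun s hs => ?_
  have hs' := Finset.mem_powerset.1 hs
  rw [Finset.sort_ge_insert hs', omegaWeight_cons,
    Finset.card_insert_of_notMem fun h => hN (hs' h), pow_succ]
  ring

section

variable {a b c d z q : ℂ}

/-- Three instances of `Psi_succ`, one of them for the interchanged weights, allow the interchanged
series to be eliminated. -/
theorem Psi_two_mul_add_two (hq : q = a * b * c * d) (m : ℕ) :
    Psi a b c d z (2 * m + 2) =
      (1 + b) * Psi a b c d z (2 * m + 1) - b * (1 - a * c * z ^ 2 * q ^ m) * Psi a b c d z (2 * m) := by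
  have h1 := Psi_succ a b c d z (2 * m)
  have h2 := Psi_succ a b c d z (2 * m + 1)
  have h3 := Psi_succ c d a b z (2 * m)
  rw [show (2 * m + 2) / 2 = m + 1 by omega, show (2 * m + 1) / 2 = m by omega] at h1 h3
  rw [show (2 * m + 1 + 2) / 2 = m + 1 by omega, show (2 * m + 1 + 1) / 2 = m + 1 by omega] at h2
  have hqm : q ^ m = a ^ m * b ^ m * c ^ m * d ^ m := by rw [hq]; ring
  rw [hqm]
  linear_combination h2 + z * a ^ (m + 1) * b ^ (m + 1) * h3 - b * h1

theorem Psi_two_mul_add_three (hq : q = a * b * c * d) (m : ℕ) :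
    Psi a b c d z (2 * m + 3) =
      (1 + a) * Psi a b c d z (2 * m + 2) -
        a * (1 - z ^ 2 * q ^ (m + 1)) * Psi a b c d z (2 * m + 1) := by
  have h1 := Psi_succ a b c d z (2 * m + 1)
  have h2 := Psi_succ a b c d z (2 * m + 2)
  have h3 := Psi_succ c d a b z (2 * m + 1)
  rw [show (2 * m + 1 + 2) / 2 = m + 1 by omega, show (2 * m + 1 + 1) / 2 = m + 1 by omega] at h1 h3
  rw [show (2 * m + 2 + 2) / 2 = m + 2 by omega, show (2 * m + 2 + 1) / 2 = m + 1 by omega] at h2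
  have hqm : q ^ (m + 1) = a ^ (m + 1) * b ^ (m + 1) * c ^ (m + 1) * d ^ (m + 1) := by rw [hq]; ring
  rw [hqm]
  linear_combination h2 + z * a ^ (m + 2) * b ^ (m + 1) * h3 - a * h1

/-- The recurrence of the generating functions with even bound on the parts. -/
theorem Psi_even_rec (hq : q = a * b * c * d) (n : ℕ) :
    Psi a b c d z (2 * (n + 2)) =
      (1 + a * b + a * (1 + b * c) * z ^ 2 * q ^ (n + 1)) * Psi a b c d z (2 * (n + 1)) -
        a * b * (1 - z ^ 2 * q ^ (n + 1)) * (1 - a * c * z ^ 2 * q ^ n) * Psi a b c d z (2 * n) := by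
  have h0 := Psi_two_mul_add_two (z := z) hq n
  have h1 := Psi_two_mul_add_three (z := z) hq n
  have h2 := Psi_two_mul_add_two (z := z) hq (n + 1)
  rw [show 2 * (n + 1) + 1 = 2 * n + 3 by ring, show 2 * (n + 1) = 2 * n + 2 by ring] at h2
  rw [show 2 * (n + 2) = 2 * n + 2 + 2 by ring, show 2 * (n + 1) = 2 * n + 2 by ring]
  linear_combination h2 + (1 + b) * h1 + a * (1 - z ^ 2 * q ^ (n + 1)) * h0

/-- The recurrence of the generating functions with odd bound on the parts. -/
theorem Psi_odd_rec (hq : q = a * b * c * d) (n : ℕ) :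
    Psi a b c d z (2 * (n + 2) + 1) =
      (1 + a * b + a * (q + b * c) * z ^ 2 * q ^ (n + 1)) * Psi a b c d z (2 * (n + 1) + 1) -
        a * b * (1 - z ^ 2 * q ^ (n + 1)) * (1 - a * c * q * z ^ 2 * q ^ n) *
          Psi a b c d z (2 * n + 1) := by
  have h0 := Psi_two_mul_add_three (z := z) hq n
  have h1 := Psi_two_mul_add_two (z := z) hq (n + 1)
  have h2 := Psi_two_mul_add_three (z := z) hq (n + 1)
  rw [show 2 * (n + 1) + 1 = 2 * n + 3 by ring, show 2 * (n + 1) = 2 * n + 2 by ring] at h1 h2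
  rw [show 2 * (n + 2) + 1 = 2 * n + 2 + 3 by ring, show 2 * (n + 1) + 1 = 2 * n + 3 by ring]
  linear_combination h2 + (1 + a) * h1 + b * (1 - a * c * z ^ 2 * q ^ (n + 1)) * h0

end

/-! ### Limit of the first solution, Casoratian and solution formula. -/

namespace ASCParams

variable {a b c d q t : ℂ}

/-- The quotient of the factors with index `N - j` of the two parameters of `phiOne` that depend
on `N`, up to the factor `d`. -/
noncomputable def phiOneRatio (a b c d q t : ℂ) (j : ℤ) : ℂ :=
  d * ((1 - q ^ (-j) * t⁻¹) / (1 + (a * b * c)⁻¹ * q ^ (-j + 1) * t⁻¹))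

/-- Since q = abcd, the quotient of the dominant terms is -1/d, which the factor d normalises to -1.
The remainder is q ^ j times a convergent factor. -/
theorem phiOneRatio_natCast (h : ASCParams a b c d q t) (j : ℕ) :
    phiOneRatio a b c d q t j =
      -1 + (q * t + a * b * c * t) * (a * b * c * t * q ^ j + q)⁻¹ * q ^ j := by
  have hq := h.q_ne
  have ha := h.a_ne
  have hb := h.b_ne
  have hc := h.c_ne
  have ht := h.t_ne
  have hw := h.w_ne (j - 1)
  have hj := pow_ne_zero j hq
  rw [zpow_sub_one₀ hq, zpow_natCast] at hw
  have hw' : a * b * c * t * q ^ j + q ≠ 0 := by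
    intro h0
    apply hw
    field_simp
    linear_combination h0
  rw [phiOneRatio, zpow_add_one₀ hq, zpow_neg, zpow_natCast]
  have e1 : 1 - (q ^ j)⁻¹ * t⁻¹ = (q ^ j * t - 1) / (q ^ j * t) := by field_simp
  have e2 : 1 + (a * b * c)⁻¹ * ((q ^ j)⁻¹ * q) * t⁻¹ =
      (a * b * c * t * q ^ j + q) / (a * b * c * t * q ^ j) := by field_simp
  rw [e1, e2]
  generalize q ^ j = Z at *
  have hd : d = q / (a * b * c) := by rw [h.q_eq]; field_simp
  rw [hd]
  generalize hD : a * b * c * t * Z + q = D at *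
  field_simp
  linear_combination -hD

theorem tendsto_denom_inv (h : ASCParams a b c d q t) :
    Tendsto (fun j : ℕ => (a * b * c * t * q ^ j + q)⁻¹) atTop (𝓝 q⁻¹) := by
  have := ((tendsto_pow_atTop_nhds_zero_of_norm_lt_one h.q_lt).const_mul
    (a * b * c * t)).add_const q
  rw [mul_zero, zero_add] at this
  exact this.inv₀ h.q_ne

theorem tendsto_phiOneRatio (h : ASCParams a b c d q t) :
    Tendsto (fun j : ℕ => phiOneRatio a b c d q t j) atTop (𝓝 (-1)) := by
  simp only [h.phiOneRatio_natCast]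
  have := ((h.tendsto_denom_inv.const_mul (q * t + a * b * c * t)).mul
    (tendsto_pow_atTop_nhds_zero_of_norm_lt_one h.q_lt)).const_add (-1)
  simpa using this

/-- The ratio tends to -1 as j → ∞ and to d as j → -∞, with geometric error on both sides, and |d| <
1. Negative indices occur because the series does not stop at k = N. -/
theorem exists_norm_phiOneRatio_le (h : ASCParams a b c d q t) :
    ∃ K : ℝ, 0 ≤ K ∧ ∀ j : ℤ, ‖phiOneRatio a b c d q t j‖ ≤ 1 + K * ‖q‖ ^ j.natAbs := by
  have hq := h.q_ne
  obtain ⟨K1, hK10, hK1⟩ := exists_norm_le_of_tendsto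
    (h.tendsto_denom_inv.const_mul (q * t + a * b * c * t))
  have hden : Tendsto (fun m : ℕ => (1 + (a * b * c)⁻¹ * (q ^ m * q) * t⁻¹)⁻¹) atTop
      (𝓝 1) := by
    have := (((((tendsto_pow_atTop_nhds_zero_of_norm_lt_one h.q_lt).mul_const q).const_mul
      (a * b * c)⁻¹).mul_const t⁻¹).const_add 1).inv₀ (by simp)
    simpa using this
  obtain ⟨K2, hK20, hK2⟩ := exists_norm_le_of_tendsto
    (hden.const_mul (-t⁻¹ - (a * b * c)⁻¹ * q * t⁻¹))
  refine ⟨max K1 K2, le_max_of_le_left hK10, fun j => ?_⟩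
  rcases le_total 0 j with hj | hj
  · lift j to ℕ using hj
    rw [h.phiOneRatio_natCast, Int.natAbs_natCast]
    refine (norm_add_le _ _).trans ?_
    rw [norm_neg, norm_one, norm_mul _ (q ^ j), norm_pow]
    gcongr
    exact (hK1 j).trans (le_max_left _ _)
  · obtain ⟨m, rfl⟩ := Int.exists_eq_neg_ofNat hj
    have hne := h.one_sub_phiOne_denom (m + 1) 0
    rw [pow_zero, mul_one, zpow_add_one₀ hq, zpow_natCast] at hne
    have hne' : 1 + (a * b * c)⁻¹ * (q ^ m * q) * t⁻¹ ≠ 0 := by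
      intro h0; apply hne; linear_combination h0
    rw [phiOneRatio, neg_neg, zpow_add_one₀ hq, zpow_natCast, Int.natAbs_neg, Int.natAbs_natCast]
    have e : (1 - q ^ m * t⁻¹) / (1 + (a * b * c)⁻¹ * (q ^ m * q) * t⁻¹) =
        1 + (-t⁻¹ - (a * b * c)⁻¹ * q * t⁻¹) * (1 + (a * b * c)⁻¹ * (q ^ m * q) * t⁻¹)⁻¹ *
          q ^ m := by
      rw [div_eq_iff hne']
      linear_combination (-((-t⁻¹ - (a * b * c)⁻¹ * q * t⁻¹) * q ^ m)) * inv_mul_cancel₀ hne'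
    rw [e, norm_mul]
    refine (mul_le_of_le_one_left (norm_nonneg _) h.d_lt.le).trans ((norm_add_le _ _).trans ?_)
    rw [norm_one, norm_mul _ (q ^ m), norm_pow]
    gcongr
    exact (hK2 m).trans (le_max_right _ _)

/-- The indices N - k are distinct, so every such product is dominated by the single convergent
product of 1 + K|q|^|j| over all integers j. -/
theorem exists_norm_prod_phiOneRatio_le (h : ASCParams a b c d q t) :
    ∃ M : ℝ, ∀ N n : ℕ, ‖∏ k ∈ Finset.range n, phiOneRatio a b c d q t (N - k)‖ ≤ M := by
  obtain ⟨K, hK0, hK⟩ := h.exists_norm_phiOneRatio_le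
  have hs : Summable fun j : ℤ => K * ‖q‖ ^ j.natAbs := by
    refine Summable.of_nat_of_neg ?_ ?_ <;>
      simpa using (summable_geometric_of_lt_one (norm_nonneg q) h.q_lt).mul_left K
  have hpos : ∀ j : ℤ, 0 ≤ K * ‖q‖ ^ j.natAbs := fun j => by positivity
  refine ⟨Real.exp (∑' j : ℤ, K * ‖q‖ ^ j.natAbs), fun N n => ?_⟩
  have hinj : Set.InjOn (fun k : ℕ => (N : ℤ) - k) (Finset.range n) := fun x _ y _ hxy => by
    simp only at hxy; omega
  rw [norm_prod, ← Finset.prod_image (f := fun j => ‖phiOneRatio a b c d q t j‖) hinj]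
  calc _ ≤ ∏ j ∈ (Finset.range n).image fun k : ℕ => (N : ℤ) - k, (1 + K * ‖q‖ ^ j.natAbs) :=
        Finset.prod_le_prod (fun _ _ => norm_nonneg _) fun j _ => hK j
    _ ≤ _ := Real.prod_one_add_le_exp_sum _ hpos
    _ ≤ _ := Real.exp_le_exp.2 (hs.sum_le_tsum _ fun j _ => hpos j)

/-- The argument is -q/c = d · (-ab); giving one d to each ratio leaves the geometric factor
(-ab)^n, with |ab| < 1. -/
theorem phiTerm_phiOne (h : ASCParams a b c d q t) (N n : ℕ) :
    phiTerm (q ^ (-(N : ℤ)) * t⁻¹) (-b⁻¹) (-(a * b * c)⁻¹ * q ^ (-(N : ℤ) + 1) * t⁻¹) q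
        (-c⁻¹ * q) n =
      (∏ k ∈ Finset.range n, phiOneRatio a b c d q t (N - k)) *
        (qPoch (-b⁻¹) q n / qPoch q q n) * (-(a * b)) ^ n := by
  have hq := h.q_ne
  have hd := h.d_ne
  have hx : -c⁻¹ * q = d * -(a * b) := by
    have := h.c_ne
    rw [h.q_eq]; field_simp
  have e : ∏ k ∈ Finset.range n, phiOneRatio a b c d q t (N - k) =
      d ^ n * (qPoch (q ^ (-(N : ℤ)) * t⁻¹) q n /
        qPoch (-(a * b * c)⁻¹ * q ^ (-(N : ℤ) + 1) * t⁻¹) q n) := by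
    simp only [phiOneRatio, qPoch]
    rw [Finset.prod_mul_distrib, Finset.prod_const, Finset.card_range, Finset.prod_div_distrib]
    have hz : ∀ k : ℕ, q ^ (-((N : ℤ) - k)) = q ^ (-(N : ℤ)) * q ^ k := fun k => by
      rw [neg_sub', sub_neg_eq_add, zpow_add₀ hq, zpow_natCast]
    congr 2
    · exact Finset.prod_congr rfl fun k _ => by rw [hz]; ring
    · exact Finset.prod_congr rfl fun k _ => by
        rw [zpow_add_one₀ hq, zpow_add_one₀ hq, hz]; ring
  rw [e, phiTerm]
  conv_lhs => rw [hx, mul_pow]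
  simp only [div_eq_mul_inv, mul_inv]
  ring

/-- Each ratio tends to -1, and these signs turn (-ab)^n into (ab)^n; the limit is ₁φ₀(-1/b; ab). -/
theorem tendsto_phiOne (h : ASCParams a b c d q t) :
    Tendsto (phiOne a b c q t) atTop (𝓝 (qPochInf (-a) q / qPochInf (a * b) q)) := by
  have hA : -b⁻¹ * (a * b) = -a := by
    have := h.b_ne
    field_simp
  rw [← hA, ← tsum_q_binomial h.q_lt h.ab_lt]
  obtain ⟨M, hM⟩ := h.exists_norm_prod_phiOneRatio_le
  obtain ⟨K, hK0, hK⟩ := exists_norm_le_of_tendsto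
    ((tendsto_qPoch h.q_lt (-b⁻¹)).div (tendsto_qPoch h.q_lt q)
      (qPochInf_ne_zero h.q_lt (one_sub_self_mul_pow_ne_zero h.q_lt)))
  have hx : ‖-(a * b)‖ < 1 := by rw [norm_neg]; exact h.ab_lt
  have hM0 : 0 ≤ M := (norm_nonneg _).trans (hM 0 0)
  refine tendsto_tsum_of_dominated_convergence (bound := fun n => M * K * ‖-(a * b)‖ ^ n)
    ((summable_geometric_of_lt_one (norm_nonneg _) hx).mul_left _) (fun n => ?_)
    (Eventually.of_forall fun N n => ?_)
  · simp only [h.phiTerm_phiOne]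
    have h1 : Tendsto (fun N : ℕ => ∏ k ∈ Finset.range n, phiOneRatio a b c d q t (N - k)) atTop
        (𝓝 (∏ k ∈ Finset.range n, (-1))) := by
      refine tendsto_finsetProd _ fun k _ => ?_
      refine (h.tendsto_phiOneRatio.comp (tendsto_sub_atTop_nat k)).congr' ?_
      filter_upwards [eventually_ge_atTop k] with N hN
      simp [Nat.cast_sub hN]
    have h2 := (h1.mul_const (qPoch (-b⁻¹) q n / qPoch q q n)).mul_const ((-(a * b)) ^ n)
    convert h2 using 2
    rw [Finset.prod_const, Finset.card_range, neg_pow (a * b)]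
    have : ((-1 : ℂ) ^ n) * (-1) ^ n = 1 := by rw [← mul_pow]; norm_num
    linear_combination (-(qPoch (-b⁻¹) q n / qPoch q q n * (a * b) ^ n)) * this
  · rw [h.phiTerm_phiOne, norm_mul, norm_mul, norm_pow]
    gcongr
    · exact hM N n
    · exact hK n

/-- The Casoratian of the two solutions. -/
theorem casoratian_zero (h : ASCParams a b c d q t) :
    solOne a b c q t 1 * solTwo a b c q t 0 - solOne a b c q t 0 * solTwo a b c q t 1 =
      qPochInf (-a) q * qPochInf (-(a * b * c * t)) q /
        (qPochInf (-(a * q * t)) q * qPochInf (-(a * b * c)) q) := by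
  have hF : Tendsto (solOne a b c q t) atTop (𝓝 _) :=
    (tendsto_qPoch h.q_lt (-(a * b * c * t))).mul h.tendsto_phiOne
  have hg : Tendsto (solTwoReduced a b c q t) atTop (𝓝 _) :=
    h.tendsto_phiTwo.div (tendsto_qPoch h.q_lt (-(a * q * t)))
      (qPochInf_ne_zero h.q_lt h.one_sub_at)
  have hp := tendsto_pow_atTop_nhds_zero_of_norm_lt_one h.q_lt
  have hB := (((((tendsto_add_atTop_iff_nat 1).2 hp).const_mul t).const_sub 1).const_mul
    (a * b)).mul ((hp.const_mul (a * c * t)).const_sub 1)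
  have hE := (((tendsto_add_atTop_iff_nat 1).2 hF).mul hg).sub
    ((hB.mul hF).mul ((tendsto_add_atTop_iff_nat 1).2 hg))
  -- The sequence is constant, so it equals its limit, which is 1 - ab times the limits of the two
  -- solutions; the factor (ab; q)_∞ then cancels.
  simp only [h.casoratian_eq] at hE
  rw [tendsto_nhds_unique tendsto_const_nhds hE]
  have h1 := qPochInf_ne_zero h.q_lt h.one_sub_at
  have h2 := qPochInf_ne_zero h.q_lt (one_sub_mul_pow_ne_zero h.q_lt h.ab_lt)
  have h3 := qPochInf_ne_zero h.q_lt (one_sub_mul_pow_ne_zero h.q_lt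
    (x := -(a * b * c)) (by rw [norm_neg]; exact h.abc_lt))
  have h4 := qPochInf_eq_mul h.q_lt (a * b)
  have h5 : 1 - a * b ≠ 0 := fun h0 => h2 (by rw [h4, h0, zero_mul])
  have h6 : qPochInf (a * b * q) q ≠ 0 := fun h0 => h2 (by rw [h4, h0, mul_zero])
  rw [h4]
  field_simp
  ring

/-- Every solution of the recurrence is a combination of the two basic hypergeometric ones. -/
theorem eq_of_rec (h : ASCParams a b c d q t) (ha : ∀ k : ℕ, 1 - -a * q ^ k ≠ 0) {X : ℕ → ℂ}
    (hX : ∀ n, X (n + 2) = (1 + a * b + a * (1 + b * c) * t * q ^ (n + 1)) * X (n + 1) -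
        a * b * (1 - t * q ^ (n + 1)) * (1 - a * c * t * q ^ n) * X n) (N : ℕ) :
    X N = qPochInf (-(a * q * t)) q * qPochInf (-(a * b * c)) q /
        (qPochInf (-a) q * qPochInf (-(a * b * c * t)) q) *
      ((solTwo a b c q t 0 * X 1 - solTwo a b c q t 1 * X 0) * solOne a b c q t N +
        (solOne a b c q t 1 * X 0 - solOne a b c q t 0 * X 1) * solTwo a b c q t N) := by
  have h1 := qPochInf_ne_zero h.q_lt h.one_sub_at
  have h2 := qPochInf_ne_zero h.q_lt ha
  have h3 := qPochInf_ne_zero h.q_lt (one_sub_mul_pow_ne_zero h.q_lt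
    (x := -(a * b * c)) (by rw [norm_neg]; exact h.abc_lt))
  have h4 := qPochInf_ne_zero h.q_lt h.one_sub_w
  set K := qPochInf (-(a * q * t)) q * qPochInf (-(a * b * c)) q /
        (qPochInf (-a) q * qPochInf (-(a * b * c * t)) q) with hK
  -- K is the reciprocal of the Casoratian, so the cases N = 0 and N = 1 are Cramer's rule.
  have hc : K * (solOne a b c q t 1 * solTwo a b c q t 0 -
      solOne a b c q t 0 * solTwo a b c q t 1) = 1 := by
    rw [h.casoratian_zero, hK, div_mul_div_comm, div_eq_one_iff_eq (by simp [*])]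
    ring
  induction N using Nat.strong_induction_on with
  | _ N ih =>
    match N, ih with
    | 0, _ => linear_combination (-X 0) * hc
    | 1, _ => linear_combination (-X 1) * hc
    | n + 2, ih =>
      rw [hX, ih (n + 1) (by omega), ih n (by omega), h.solOne_rec, h.solTwo_rec]
      ring

end ASCParams

/-! ### Normalised recurrence and the main theorem. -/

/-- The passage from the recurrence of `P` to the one of `u⁻ⁿ Pₙ`. -/
theorem assocASCRecurrence_of_rec {a b q t u α β s p : ℂ} {P : ℕ → ℂ} (hu0 : u ≠ 0)
    (hu : u ^ 2 = a * b) (hs : u * (α + β) = -s) (hp : α * β = p)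
    (hP : ∀ n, P (n + 2) = (1 + a * b + s * t * q ^ (n + 1)) * P (n + 1) -
        a * b * (1 - t * q ^ (n + 1)) * (1 - p * t * q ^ n) * P n) :
    AssocASCRecurrence ((u + u⁻¹) / 2) α β t q (fun N => (u ^ N)⁻¹ * P N) := by
  intro n
  have hun := pow_ne_zero n hu0
  simp only [hP]
  rw [← hu, ← hp, ← neg_eq_iff_eq_neg.2 hs]
  field_simp
  ring

theorem mainTheorem3 (a b c d z q : ℂ)
    (ha : ‖a‖ < 1) (hb : ‖b‖ < 1) (hc : ‖c‖ < 1) (hd : ‖d‖ < 1)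
    (ha0 : a ≠ 0) (hb0 : b ≠ 0) (hc0 : c ≠ 0) (hd0 : d ≠ 0) (hz0 : z ≠ 0)
    (hq : q = a * b * c * d)
    (habc : ∀ k : ℤ, 1 + a * b * c * z ^ 2 * q ^ k ≠ 0) :
    -- the infinite products converge and those in the denominators do not vanish
    (∀ x : ℂ, Multipliable fun k : ℕ => 1 - x * q ^ k) ∧
    qPochInf (-a) q ≠ 0 ∧ qPochInf (-(a * q)) q ≠ 0 ∧
    qPochInf (-(a * b * c * z ^ 2)) q ≠ 0 ∧
    -- part (i)
    ((∀ k : ℕ, 1 ≤ k → 1 + a * z ^ 2 * q ^ k ≠ 0) →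
      let X : ℕ → ℂ := fun N => Psi a b c d z (2 * N)
      let φ₁ : ℕ → ℂ := fun N =>
        phi (q ^ (-(N : ℤ)) * (z ^ 2)⁻¹) (-b⁻¹)
          (-(a * b * c)⁻¹ * q ^ (-(N : ℤ) + 1) * (z ^ 2)⁻¹) q (-c⁻¹ * q)
      let φ₂ : ℕ → ℂ := fun N =>
        phi (q ^ (N + 1) * z ^ 2) (-c⁻¹ * q) (-(a * q ^ (N + 1) * z ^ 2)) q (-(a * b * c))
      let F₁ : ℕ → ℂ := fun N => qPoch (-(a * b * c * z ^ 2)) q N * φ₁ N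
      let F₂ : ℕ → ℂ := fun N => (a * b) ^ N *
        (qPoch (q * z ^ 2) q N * qPoch (a * c * z ^ 2) q N / qPoch (-(a * q * z ^ 2)) q N) * φ₂ N
      let r₀ : ℂ := phi (z ^ 2)⁻¹ (-b⁻¹) (-(a * b * c)⁻¹ * (z ^ 2)⁻¹ * q) q (-c⁻¹ * q)
      let s₀ : ℂ := phi (z ^ 2 * q) (-c⁻¹ * q) (-(a * z ^ 2 * q)) q (-(a * b * c))
      let r₁ : ℂ := (1 + a * b * c * z ^ 2) *
        phi ((z ^ 2)⁻¹ * q⁻¹) (-b⁻¹) (-(a * b * c)⁻¹ * (z ^ 2)⁻¹) q (-c⁻¹ * q)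
      let s₁ : ℂ := a * b * (1 - z ^ 2 * q) * (1 - a * c * z ^ 2) / (1 + a * z ^ 2 * q) *
        phi (z ^ 2 * q ^ 2) (-c⁻¹ * q) (-(a * z ^ 2 * q ^ 2)) q (-(a * b * c))
      -- all series converge (`r₀`, `r₁` use the series `φ₁ 0`, `φ₁ 1`; `s₀`, `s₁` use `φ₂ 0`, `φ₂ 1`)
      (∀ N : ℕ,
        PhiConverges (q ^ (-(N : ℤ)) * (z ^ 2)⁻¹) (-b⁻¹)
          (-(a * b * c)⁻¹ * q ^ (-(N : ℤ) + 1) * (z ^ 2)⁻¹) q (-c⁻¹ * q) ∧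
        PhiConverges (q ^ (N + 1) * z ^ 2) (-c⁻¹ * q) (-(a * q ^ (N + 1) * z ^ 2)) q
          (-(a * b * c))) ∧
      -- the two solutions of the associated Al-Salam–Chihara recurrence
      (∀ u : ℂ, u ^ 2 = a * b →
        AssocASCRecurrence ((u + u⁻¹) / 2) (-(u * c)) (-(a / u)) (z ^ 2) q
          (fun N => (u ^ N)⁻¹ * F₁ N) ∧
        AssocASCRecurrence ((u + u⁻¹) / 2) (-(u * c)) (-(a / u)) (z ^ 2) q
          (fun N => (u ^ N)⁻¹ * F₂ N)) ∧
      -- the explicit formula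
      ∀ N : ℕ, X N =
        qPochInf (-(a * z ^ 2 * q)) q * qPochInf (-(a * b * c)) q /
            (qPochInf (-a) q * qPochInf (-(a * b * c * z ^ 2)) q) *
          ((s₀ * X 1 - s₁ * X 0) * F₁ N + (r₁ * X 0 - r₀ * X 1) * F₂ N)) ∧
    -- part (ii)
    ((∀ k : ℕ, 2 ≤ k → 1 + a * z ^ 2 * q ^ k ≠ 0) →
      let Y : ℕ → ℂ := fun N => Psi a b c d z (2 * N + 1)
      let φ₁ : ℕ → ℂ := fun N =>
        phi (q ^ (-(N : ℤ)) * (z ^ 2)⁻¹) (-(a * c * d))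
          (-(a * b * c)⁻¹ * q ^ (-(N : ℤ) + 1) * (z ^ 2)⁻¹) q (-c⁻¹ * q)
      let φ₂ : ℕ → ℂ := fun N =>
        phi (q ^ (N + 1) * z ^ 2) (-c⁻¹ * q) (-(a * q ^ (N + 2) * z ^ 2)) q (-(a * b * c))
      let F₁ : ℕ → ℂ := fun N => qPoch (-(a * b * c * z ^ 2)) q N * φ₁ N
      let F₂ : ℕ → ℂ := fun N => (a * b) ^ N *
        (qPoch (q * z ^ 2) q N * qPoch (a * c * q * z ^ 2) q N /
          qPoch (-(a * q ^ 2 * z ^ 2)) q N) * φ₂ N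
      let r₀ : ℂ := phi (z ^ 2)⁻¹ (-(a * c * d)) (-(a * b * c)⁻¹ * q * (z ^ 2)⁻¹) q (-c⁻¹ * q)
      let r₁ : ℂ := (1 + a * b * c * z ^ 2) *
        phi (q⁻¹ * (z ^ 2)⁻¹) (-(a * c * d)) (-(a * b * c)⁻¹ * (z ^ 2)⁻¹) q (-c⁻¹ * q)
      let s₀ : ℂ := phi (z ^ 2 * q) (-c⁻¹ * q) (-(a * q ^ 2 * z ^ 2)) q (-(a * b * c))
      let s₁ : ℂ := a * b * (1 - z ^ 2 * q) * (1 - a * c * q * z ^ 2) / (1 + a * q ^ 2 * z ^ 2) *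
        phi (z ^ 2 * q ^ 2) (-c⁻¹ * q) (-(a * q ^ 3 * z ^ 2)) q (-(a * b * c))
      -- all series converge (`r₀`, `r₁` use the series `φ₁ 0`, `φ₁ 1`; `s₀`, `s₁` use `φ₂ 0`, `φ₂ 1`)
      (∀ N : ℕ,
        PhiConverges (q ^ (-(N : ℤ)) * (z ^ 2)⁻¹) (-(a * c * d))
          (-(a * b * c)⁻¹ * q ^ (-(N : ℤ) + 1) * (z ^ 2)⁻¹) q (-c⁻¹ * q) ∧
        PhiConverges (q ^ (N + 1) * z ^ 2) (-c⁻¹ * q) (-(a * q ^ (N + 2) * z ^ 2)) q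
          (-(a * b * c))) ∧
      -- the two solutions of the associated Al-Salam–Chihara recurrence
      (∀ u : ℂ, u ^ 2 = a * b →
        AssocASCRecurrence ((u + u⁻¹) / 2) (-(u * c)) (-(a * u * c * d)) (z ^ 2) q
          (fun N => (u ^ N)⁻¹ * F₁ N) ∧
        AssocASCRecurrence ((u + u⁻¹) / 2) (-(u * c)) (-(a * u * c * d)) (z ^ 2) q
          (fun N => (u ^ N)⁻¹ * F₂ N)) ∧
      -- the explicit formula
      ∀ N : ℕ, Y N =
        qPochInf (-(a * q ^ 2 * z ^ 2)) q * qPochInf (-(a * b * c)) q /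
            (qPochInf (-(a * q)) q * qPochInf (-(a * b * c * z ^ 2)) q) *
          ((s₀ * Y 1 - s₁ * Y 0) * F₁ N + (r₁ * Y 0 - r₀ * Y 1) * F₂ N)) := by 
  have hq0 : q ≠ 0 := by
    rw [hq]; exact mul_ne_zero (mul_ne_zero (mul_ne_zero ha0 hb0) hc0) hd0
  have hmul : ∀ x y : ℂ, ‖x‖ < 1 → ‖y‖ < 1 → ‖x * y‖ < 1 := fun x y hx hy => by
    rw [norm_mul]; exact mul_lt_one_of_nonneg_of_lt_one_left (norm_nonneg _) hx hy.le
  have hab := hmul _ _ ha hb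
  have habc1 := hmul _ _ hab hc
  have hq1 : ‖q‖ < 1 := by rw [hq]; exact hmul _ _ habc1 hd
  have hz2 : z ^ 2 ≠ 0 := pow_ne_zero 2 hz0
  have hA : ∀ k : ℕ, 1 - -a * q ^ k ≠ 0 :=
    one_sub_mul_pow_ne_zero hq1 (by rwa [norm_neg])
  have hAq : ∀ k : ℕ, 1 - -(a * q) * q ^ k ≠ 0 :=
    one_sub_mul_pow_ne_zero hq1 (by rw [norm_neg]; exact hmul _ _ ha hq1)
  refine ⟨multipliable_one_sub_mul_pow hq1, qPochInf_ne_zero hq1 hA, qPochInf_ne_zero hq1 hAq,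
    qPochInf_ne_zero hq1 fun k => by simpa [sub_eq_add_neg] using habc k, ?_, ?_⟩
  · intro hat X φ₁ φ₂ F₁ F₂ r₀ s₀ r₁ s₁
    have h : ASCParams a b c d q (z ^ 2) :=
      ⟨ha0, hb0, hc0, hd0, hz2, hq, hq1, hab, habc1, hd, hmul _ _ hab hd, habc, hat⟩
    have hF₁ : F₁ = solOne a b c q (z ^ 2) := rfl
    have hF₂ : F₂ = solTwo a b c q (z ^ 2) := rfl
    have hr₀ : r₀ = solOne a b c q (z ^ 2) 0 := by
      simp only [r₀, solOne, phiOne, qPoch_zero, one_mul]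
      congr 1 <;> simp
      ring
    have hr₁ : r₁ = solOne a b c q (z ^ 2) 1 := by
      simp only [r₁, solOne, phiOne, qPoch_succ, qPoch_zero]
      congr 1
      · ring
      · congr 1 <;> simp
        ring
    have hs₀ : s₀ = solTwo a b c q (z ^ 2) 0 := by
      simp only [s₀, solTwo, phiTwo, qPoch_zero]
      simp only [pow_zero, zero_add, pow_one, mul_one, div_one, one_mul]
      congr 1 <;> ring
    have hs₁ : s₁ = solTwo a b c q (z ^ 2) 1 := by
      simp only [s₁, solTwo, phiTwo, qPoch_succ, qPoch_zero]
      congr 1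
      · simp only [pow_zero, pow_one, mul_one, one_mul, sub_neg_eq_add]
        rw [mul_comm (z ^ 2) q, mul_right_comm a (z ^ 2) q]
        ring
      · congr 1 <;> ring
    refine ⟨fun N => ⟨h.phiConverges_phiOne N, h.phiConverges_phiTwo N⟩, fun u hu => ?_,
      fun N => ?_⟩
    · have hu0 : u ≠ 0 := by
        rintro rfl; exact mul_ne_zero ha0 hb0 (by rw [← hu]; ring)
      have e1 : u * (-(u * c) + -(a / u)) = -(a * (1 + b * c)) := by
        field_simp
        linear_combination (-c) * hu
      have e2 : -(u * c) * -(a / u) = a * c := by field_simp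
      exact ⟨assocASCRecurrence_of_rec hu0 hu e1 e2 h.solOne_rec,
        assocASCRecurrence_of_rec hu0 hu e1 e2 h.solTwo_rec⟩
    · rw [hr₀, hr₁, hs₀, hs₁, hF₁, hF₂, mul_right_comm a (z ^ 2) q]
      exact h.eq_of_rec hA (X := X) (fun n => Psi_even_rec hq n) N
  · intro hat Y φ₁ φ₂ F₁ F₂ r₀ r₁ s₀ s₁
    -- Part (ii) is the same theory at (aq, b/q, c, d), with the same ab and q. The modulus of b/q
    -- need not be below 1, which is why `ASCParams` bounds only products such as ab and abd,
    -- besides d and q.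
    have hb' : b / q ≠ 0 := div_ne_zero hb0 hq0
    have hab' : a * q * (b / q) = a * b := by field_simp
    have hinv : -(b / q)⁻¹ = -(a * c * d) := by rw [inv_div, hq]; field_simp
    have h : ASCParams (a * q) (b / q) c d q (z ^ 2) := by
      refine ⟨mul_ne_zero ha0 hq0, hb', hc0, hd0, hz2, ?_, hq1, ?_, ?_, hd, ?_, ?_, ?_⟩
      · rwa [hab']
      · rwa [hab']
      · rwa [hab']
      · rw [hab']; exact hmul _ _ hab hd
      · rwa [hab']
      · intro k hk h0
        -- The extra q in aq shifts the exponent by one, so the condition is needed only from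
        -- exponent 2 on.
        exact hat (k + 1) (by omega) (by rw [pow_succ]; linear_combination h0)
    have hφ₁ : φ₁ = phiOne (a * q) (b / q) c q (z ^ 2) := by
      funext N
      simp only [φ₁, phiOne, hab', hinv]
    have hφ₂ : φ₂ = phiTwo (a * q) (b / q) c q (z ^ 2) := by
      funext N
      simp only [φ₂, phiTwo, hab']
      congr 1; ring
    have hF₁ : F₁ = solOne (a * q) (b / q) c q (z ^ 2) := by
      funext N
      simp only [F₁, solOne, hφ₁, hab']
    have hF₂ : F₂ = solTwo (a * q) (b / q) c q (z ^ 2) := by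
      funext N
      simp only [F₂, solTwo, hφ₂, hab']
      rw [show a * c * q * z ^ 2 = a * q * c * z ^ 2 by ring,
        show a * q ^ 2 * z ^ 2 = a * q * q * z ^ 2 by ring]
    have hr₀ : r₀ = solOne (a * q) (b / q) c q (z ^ 2) 0 := by
      simp only [r₀, solOne, phiOne, qPoch_zero, one_mul, hab', hinv]
      congr 1 <;> simp
    have hr₁ : r₁ = solOne (a * q) (b / q) c q (z ^ 2) 1 := by
      simp only [r₁, solOne, phiOne, qPoch_succ, qPoch_zero, hab', hinv]
      congr 1
      · ring
      · congr 1 <;> simp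
    have hs₀ : s₀ = solTwo (a * q) (b / q) c q (z ^ 2) 0 := by
      simp only [s₀, solTwo, phiTwo, qPoch_zero, hab']
      simp only [pow_zero, zero_add, pow_one, mul_one, div_one, one_mul]
      congr 1 <;> ring
    have hs₁ : s₁ = solTwo (a * q) (b / q) c q (z ^ 2) 1 := by
      simp only [s₁, solTwo, phiTwo, qPoch_succ, qPoch_zero, hab']
      congr 1
      · simp only [pow_zero, pow_one, mul_one, one_mul, sub_neg_eq_add]
        rw [mul_comm (z ^ 2) q, show a * c * q * z ^ 2 = a * q * c * z ^ 2 by ring,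
          show a * q ^ 2 * z ^ 2 = a * q * q * z ^ 2 by ring]
        ring
      · congr 1 <;> ring
    refine ⟨fun N => ⟨?_, ?_⟩, fun u hu => ?_, fun N => ?_⟩
    · have := h.phiConverges_phiOne N
      rwa [hab', hinv] at this
    · have := h.phiConverges_phiTwo N
      rwa [hab', show a * q * q ^ (N + 1) * z ^ 2 = a * q ^ (N + 2) * z ^ 2 by ring] at this
    · have hu0 : u ≠ 0 := by
        rintro rfl; exact mul_ne_zero ha0 hb0 (by rw [← hu]; ring)
      have e1 : u * (-(u * c) + -(a * u * c * d)) = -(a * q * (1 + b / q * c)) := by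
        rw [mul_add (a * q), mul_one, ← mul_assoc (a * q), hab']
        linear_combination (-c - a * c * d) * hu + a * hq
      have e2 : -(u * c) * -(a * u * c * d) = a * q * c := by
        linear_combination (a * c ^ 2 * d) * hu - a * c * hq
      rw [hF₁, hF₂]
      rw [← hab'] at hu
      exact ⟨assocASCRecurrence_of_rec hu0 hu e1 e2 h.solOne_rec,
        assocASCRecurrence_of_rec hu0 hu e1 e2 h.solTwo_rec⟩
    · rw [hr₀, hr₁, hs₀, hs₁, hF₁, hF₂, show a * q ^ 2 * z ^ 2 = a * q * q * z ^ 2 by ring]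
      have := h.eq_of_rec hAq (X := Y) (fun n => ?_) N
      · rwa [hab'] at this
      · have e : a * q * (1 + b / q * c) = a * (q + b * c) := by field_simp
        rw [e, hab', mul_right_comm a q c]
        exact Psi_odd_rec hq n
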